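/- For a non-empty bounded set $E\subset\mathbb{R}$ let $N_r(E)$ be the least number of open balls of radius $r$ required to cover $E$, and let $\underline{\dim}_{\mathrm B}E=\liminf_{r\to0}\frac{\log N_r(E)}{\log(1/r)}$ and $\overline{\dim}_{\mathrm B}E=\limsup_{r\to0}\frac{\log N_r(E)}{\log(1/r)}$; the box dimension of $E$ exists if these two numbers are equal. Let $\mathbb{N}=\{1,2,3,\dots\}$, and for $I\subset\mathbb{N}$ let $$\Lambda_I=\left\{z\in(0,1)\setminus\mathbb{Q} : z=\cfrac{1}{b_1+\cfrac{1}{b_2+\cfrac{1}{\ddots}}}\ \text{ with } b_n\in I \text{ for all } n\in\mathbb{N}\right\}.$$ (1) For every $0<a<1$ there is an infinite proper subset $I\subset\mathbb{N}$ such that $\Lambda_I\subset(0,a)$ and the box dimension of $\Lambda_I$ does not exist. (2) There is a Borel set $\Lambda\subset(0,1)$ which is invariant under the Gauss map $g(x)=1/x \bmod 1$, that is, $g(\Lambda)=\Lambda$, and whose box dimension does not exist. -/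

import Mathlib

open Filter Topology

/-- `N_r(E)`: the least number of open balls of radius `r` required to cover `E`. It is used for
totally bounded sets, for which such finite covers exist for every `r > 0`. -/
noncomputable def ballCoveringNumber {X : Type*} [MetricSpace X] (r : ℝ) (E : Set X) : ℕ :=
  sInf {n : ℕ | ∃ C : Finset X, C.card = n ∧ E ⊆ ⋃ x ∈ C, Metric.ball x r}

/-- The lower box dimension `liminf_{r → 0} log N_r(E) / log (1/r)`. -/
noncomputable def lowerBoxDim {X : Type*} [MetricSpace X] (E : Set X) : EReal :=
  liminf (fun r : ℝ => ((Real.log (ballCoveringNumber r E) / Real.log (1 / r) : ℝ) : EReal))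
    (𝓝[>] 0)

/-- The upper box dimension `limsup_{r → 0} log N_r(E) / log (1/r)`. -/
noncomputable def upperBoxDim {X : Type*} [MetricSpace X] (E : Set X) : EReal :=
  limsup (fun r : ℝ => ((Real.log (ballCoveringNumber r E) / Real.log (1 / r) : ℝ) : EReal))
    (𝓝[>] 0)

/-- The box dimension of `E` exists if the lower and upper box dimensions coincide. -/
def BoxDimExists {X : Type*} [MetricSpace X] (E : Set X) : Prop :=
  lowerBoxDim E = upperBoxDim E

/-- The formal infinite continued fraction `1 / (b 0 + 1 / (b 1 + 1 / (b 2 + ⋯)))`. -/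
noncomputable def digitContFract (b : ℕ → ℕ+) : GenContFract ℝ :=
  ⟨0, Stream'.Seq.ofStream fun n => ⟨1, ((b n : ℕ) : ℝ)⟩⟩

/-- The continued fraction set `Λ_I`: all irrational `z ∈ (0, 1)` which are the value (the limit of
the finite truncations) of an infinite continued fraction all of whose digits lie in `I`. -/
def contFractSet (I : Set ℕ+) : Set ℝ :=
  {z : ℝ | z ∈ Set.Ioo 0 1 ∧ Irrational z ∧
    ∃ b : ℕ → ℕ+, (∀ n, b n ∈ I) ∧ Tendsto (digitContFract b).convs' atTop (𝓝 z)}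

/-- The Gauss map `x ↦ 1 / x mod 1`, with the circle `ℝ / ℤ` represented by `[0, 1)`.
It is only applied to points of `(0, 1)`. -/
noncomputable def gaussMap (x : ℝ) : ℝ := Int.fract (1 / x)

/-! The alphabet is a union of blocks of `m` digits spaced `m` apart in `[m², 2m²)`, with `m = m_k`
and `m_{k+1} = m_k ^ 100`. Two families of scales see different dimensions.

At `r ≈ m_k⁻³` the block itself is visible: points with distinct first digits in it are separated by
about `m_k⁻³`, so `N_r ≥ m_k` and the ratio is near `1/3` (`le_sparse_ratio`).

At `r = m_{k+1}⁻²` all later blocks fall into the single ball around `0`. The earlier digits form a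
finite alphabet `F` with `∑ b ^ (-2s) ≤ 1/2` for `s = 3/10`, and self-similarity gives `N_r ≤ C r⁻ˢ`
(`exists_cover_card_le`). Here `C` depends only on `m_k` and is negligible against `r⁻ˢ`, so the
ratio is at most `31/100` (`sparse_ratio_le`).

Any `s` in `(1/4, 1/3)` could serve: a block contributes about `m ^ (1 - 4s)`. Invariance holds
because `Λ_I` is the union of its images under the inverse branches with digits in `I`. -/

/-! ### Inverse branches and Gauss invariance. -/

theorem digitContFract_convs'_zero (b : ℕ → ℕ+) : (digitContFract b).convs' 0 = 0 := by
  simp [GenContFract.convs', GenContFract.convs'Aux, show (digitContFract b).h = 0 from rfl]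

theorem digitContFract_convs'_succ (b : ℕ → ℕ+) (n : ℕ) :
    (digitContFract b).convs' (n + 1) =
      1 / ((b 0 : ℕ) + (digitContFract fun i => b (i + 1)).convs' n) := by
  have h : (digitContFract b).s.head = some ⟨1, (b 0 : ℕ)⟩ := rfl
  have ht : (digitContFract b).s.tail = (digitContFract fun i => b (i + 1)).s := rfl
  have h0 (d : ℕ → ℕ+) : (digitContFract d).h = 0 := rfl
  simp only [GenContFract.convs', GenContFract.convs'Aux, h, ht, h0, zero_add]

theorem digitContFract_convs'_mem_Icc (b : ℕ → ℕ+) (n : ℕ) :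
    (digitContFract b).convs' n ∈ Set.Icc (0 : ℝ) 1 := by
  induction n generalizing b with
  | zero => rw [digitContFract_convs'_zero]; simp
  | succ n ih =>
    rw [digitContFract_convs'_succ]
    have h1 : (1 : ℝ) ≤ (b 0 : ℕ) := Nat.one_le_cast.2 (b 0).pos
    have h2 := (ih fun i => b (i + 1)).1
    exact ⟨by positivity, by rw [div_le_one (by linarith)]; linarith⟩

/-- Each inverse branch `x ↦ 1 / (b + x)` contracts `[0, ∞)` by the factor `b⁻²`. -/
theorem abs_inverseBranch_sub_le {b x y : ℝ} (hb : 1 ≤ b) (hx : 0 ≤ x) (hy : 0 ≤ y) :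
    |1 / (b + x) - 1 / (b + y)| ≤ |x - y| / b ^ 2 := by
  have h : 1 / (b + x) - 1 / (b + y) = (y - x) / ((b + x) * (b + y)) := by
    field_simp
    ring
  rw [h, abs_div, abs_sub_comm y x, abs_of_pos (by positivity : 0 < (b + x) * (b + y))]
  gcongr
  nlinarith

theorem exists_inverseBranch_of_mem_contFractSet {I : Set ℕ+} {z : ℝ} (hz : z ∈ contFractSet I) :
    ∃ b ∈ I, ∃ w ∈ contFractSet I, z = 1 / ((b : ℕ) + w) := by
  obtain ⟨⟨hz0, hz1⟩, hirr, b, hb, hlim⟩ := hz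
  have hw : Tendsto (digitContFract fun i => b (i + 1)).convs' atTop (𝓝 (1 / z - (b 0 : ℕ))) := by
    have h1 := ((hlim.comp (tendsto_add_atTop_nat 1)).inv₀ hz0.ne').sub_const ((b 0 : ℕ) : ℝ)
    rw [one_div]
    refine h1.congr fun n => ?_
    simp [digitContFract_convs'_succ]
  have hmem : 1 / z - (b 0 : ℕ) ∈ Set.Icc (0 : ℝ) 1 :=
    isClosed_Icc.mem_of_tendsto hw (Eventually.of_forall fun n => digitContFract_convs'_mem_Icc _ n)
  -- The limit is only known to lie in `[0, 1]`; irrationality excludes the endpoints.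
  have hirr' : Irrational (1 / z - (b 0 : ℕ)) := by
    rw [one_div]
    exact hirr.inv.sub_natCast _
  refine ⟨b 0, hb 0, 1 / z - (b 0 : ℕ), ⟨⟨hmem.1.lt_of_ne' hirr'.ne_zero,
    hmem.2.lt_of_ne hirr'.ne_one⟩, hirr', _, fun n => hb _, hw⟩, ?_⟩
  simp

theorem inverseBranch_mem_contFractSet {I : Set ℕ+} {b : ℕ+} (hb : b ∈ I) {w : ℝ}
    (hw : w ∈ contFractSet I) : 1 / ((b : ℕ) + w) ∈ contFractSet I := by
  obtain ⟨⟨hw0, hw1⟩, hirr, d, hd, hlim⟩ := hw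
  have h1 : (1 : ℝ) ≤ (b : ℕ) := Nat.one_le_cast.2 b.pos
  refine ⟨⟨by positivity, by rw [div_lt_one (by linarith)]; linarith⟩, ?_,
    fun n => Nat.casesOn n b d, fun n => ?_, ?_⟩
  · rw [one_div]
    exact (hirr.natCast_add _).inv
  · cases n with
    | zero => exact hb
    | succ n => exact hd n
  · rw [← tendsto_add_atTop_iff_nat 1]
    simp only [digitContFract_convs'_succ]
    exact tendsto_const_nhds.div (tendsto_const_nhds.add hlim) (by positivity)

theorem gaussMap_inverseBranch (b : ℕ+) {w : ℝ} (hw : w ∈ Set.Ioo (0 : ℝ) 1) :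
    gaussMap (1 / ((b : ℕ) + w)) = w := by
  rw [gaussMap, one_div_one_div, Int.fract_natCast_add, Int.fract_eq_self]
  exact ⟨hw.1.le, hw.2⟩

theorem gaussMap_image_contFractSet {I : Set ℕ+} (hI : I.Nonempty) :
    gaussMap '' contFractSet I = contFractSet I := by
  ext w
  constructor
  · rintro ⟨z, hz, rfl⟩
    obtain ⟨b, -, w, hw, rfl⟩ := exists_inverseBranch_of_mem_contFractSet hz
    rwa [gaussMap_inverseBranch b hw.1]
  · intro hw
    obtain ⟨b, hb⟩ := hI
    exact ⟨_, inverseBranch_mem_contFractSet hb hw, gaussMap_inverseBranch b hw.1⟩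

/-! ### Digits along Gauss orbits: measurability and non-emptiness. -/

/-- The first continued fraction digit of `x ∈ (0, 1)`. -/
noncomputable def gaussDigit (x : ℝ) : ℕ+ := ⌊1 / x⌋₊.toPNat'

theorem gaussDigit_coe {x : ℝ} (hx : x ∈ Set.Ioo (0 : ℝ) 1) :
    ((gaussDigit x : ℕ) : ℝ) = 1 / x - gaussMap x := by
  have h1 : 1 ≤ 1 / x := by rw [le_div_iff₀ hx.1]; linarith [hx.2]
  have h2 : 0 < ⌊1 / x⌋₊ := Nat.floor_pos.2 h1
  rw [gaussDigit, Nat.toPNat'_coe, if_pos h2, gaussMap, Int.fract,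
    ← natCast_floor_eq_intCast_floor (by linarith)]
  ring

theorem gaussDigit_inverseBranch (b : ℕ+) {w : ℝ} (hw : w ∈ Set.Ioo (0 : ℝ) 1) :
    gaussDigit (1 / ((b : ℕ) + w)) = b := by
  have h : ⌊1 / (1 / (((b : ℕ) : ℝ) + w))⌋₊ = b := by
    rw [one_div_one_div, add_comm, Nat.floor_add_natCast hw.1.le,
      Nat.floor_eq_zero.2 hw.2, zero_add]
  rw [gaussDigit, h]
  exact PNat.coe_toPNat' b

theorem eq_inverseBranch_gaussMap {x : ℝ} (hx : x ∈ Set.Ioo (0 : ℝ) 1) :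
    x = 1 / ((gaussDigit x : ℕ) + gaussMap x) := by
  rw [gaussDigit_coe hx]
  simp

theorem gaussMap_mem_Ioo {x : ℝ} (hirr : Irrational x) :
    gaussMap x ∈ Set.Ioo (0 : ℝ) 1 ∧ Irrational (gaussMap x) := by
  have h : Irrational (gaussMap x) := by
    rw [gaussMap, Int.fract, one_div]
    exact hirr.inv.sub_intCast _
  exact ⟨⟨(Int.fract_nonneg _).lt_of_ne' h.ne_zero, Int.fract_lt_one _⟩, h⟩

theorem abs_convs'_gaussDigit_sub_le {x : ℝ} (hx : x ∈ Set.Ioo (0 : ℝ) 1) (hirr : Irrational x)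
    (hd : ∀ n, 2 ≤ gaussDigit (gaussMap^[n] x)) (n : ℕ) :
    |(digitContFract fun i => gaussDigit (gaussMap^[i] x)).convs' n - x| ≤ (1 / 2) ^ n := by
  induction n generalizing x with
  | zero =>
    rw [digitContFract_convs'_zero, zero_sub, abs_neg, abs_of_pos hx.1, pow_zero]
    exact hx.2.le
  | succ n ih =>
    obtain ⟨hg, hgirr⟩ := gaussMap_mem_Ioo hirr
    have h := ih hg hgirr fun n => hd (n + 1)
    have h2 : (2 : ℝ) ≤ (gaussDigit x : ℕ) := by exact_mod_cast hd 0
    have hcontr := abs_inverseBranch_sub_le (by linarith : (1 : ℝ) ≤ (gaussDigit x : ℕ))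
      (digitContFract_convs'_mem_Icc (fun i => gaussDigit (gaussMap^[i] (gaussMap x))) n).1 hg.1.le
    rw [← eq_inverseBranch_gaussMap hx] at hcontr
    have h4 : (2 : ℝ) ≤ ((gaussDigit x : ℕ) : ℝ) ^ 2 := by nlinarith
    rw [digitContFract_convs'_succ, pow_succ]
    refine hcontr.trans ?_
    rw [div_eq_mul_one_div]
    exact mul_le_mul h (one_div_le_one_div_of_le two_pos h4)
      (one_div_nonneg.2 (sq_nonneg _)) (by positivity)

/-- Replaces the existential over digit sequences by countably many measurable conditions. Digits at
least `2` make every branch a uniform contraction, so the convergents of the orbit digits converge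
geometrically. -/
theorem mem_contFractSet_iff {I : Set ℕ+} (hI : ∀ b ∈ I, 2 ≤ b) {x : ℝ} :
    x ∈ contFractSet I ↔
      x ∈ Set.Ioo (0 : ℝ) 1 ∧ Irrational x ∧ ∀ n, gaussDigit (gaussMap^[n] x) ∈ I := by
  constructor
  · intro hx
    refine ⟨hx.1, hx.2.1, fun n => ?_⟩
    have key : ∀ z ∈ contFractSet I, gaussDigit z ∈ I ∧ gaussMap z ∈ contFractSet I := by
      intro z hz
      obtain ⟨b, hb, w, hw, rfl⟩ := exists_inverseBranch_of_mem_contFractSet hz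
      rw [gaussDigit_inverseBranch b hw.1, gaussMap_inverseBranch b hw.1]
      exact ⟨hb, hw⟩
    have hmem : gaussMap^[n] x ∈ contFractSet I := by
      induction n with
      | zero => exact hx
      | succ n ih =>
        rw [Function.iterate_succ_apply']
        exact (key _ ih).2
    exact (key _ hmem).1
  · rintro ⟨hx, hirr, hd⟩
    refine ⟨hx, hirr, fun i => gaussDigit (gaussMap^[i] x), hd, ?_⟩
    rw [tendsto_iff_dist_tendsto_zero]
    exact squeeze_zero (fun _ => dist_nonneg)
      (abs_convs'_gaussDigit_sub_le hx hirr fun n => hI _ (hd n))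
      (tendsto_pow_atTop_nhds_zero_of_lt_one (by norm_num) (by norm_num))

theorem measurable_gaussMap : Measurable gaussMap :=
  (measurable_const.div measurable_id).fract

theorem measurableSet_contFractSet {I : Set ℕ+} (hI : ∀ b ∈ I, 2 ≤ b) :
    MeasurableSet (contFractSet I) := by
  have hirr : MeasurableSet {x : ℝ | Irrational x} :=
    (Set.countable_range ((↑) : ℚ → ℝ)).measurableSet.compl
  have hdig (n : ℕ) : MeasurableSet {x : ℝ | gaussDigit (gaussMap^[n] x) ∈ I} := by
    have h : Measurable fun x : ℝ => ⌊1 / gaussMap^[n] x⌋₊ :=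
      (measurable_const.div (measurable_gaussMap.iterate n)).nat_floor
    exact h (MeasurableSet.of_discrete (s := {k : ℕ | k.toPNat' ∈ I}))
  have h : contFractSet I = Set.Ioo (0 : ℝ) 1 ∩ ({x | Irrational x} ∩
      ⋂ n, {x : ℝ | gaussDigit (gaussMap^[n] x) ∈ I}) := by
    ext x
    simp [mem_contFractSet_iff hI]
  rw [h]
  exact measurableSet_Ioo.inter (hirr.inter (MeasurableSet.iInter hdig))

theorem contFractSet_nonempty {I : Set ℕ+} (hI : ∀ b ∈ I, 2 ≤ b) (hne : I.Nonempty) :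
    (contFractSet I).Nonempty := by
  obtain ⟨b, hb⟩ := hne
  have hb2 : 2 ≤ (b : ℕ) := by exact_mod_cast hI b hb
  have hb2' : (2 : ℝ) ≤ (b : ℕ) := by exact_mod_cast hb2
  -- The witness is `[b, b, b, …] = (√(b² + 4) - b) / 2`; it is irrational since `b² < b² + 4 < (b +
  -- 1)²` for `b ≥ 2`.
  set s : ℝ := √(((b : ℕ) ^ 2 + 4 : ℕ) : ℝ) with hs
  have hsq : s ^ 2 = ((b : ℕ) : ℝ) ^ 2 + 4 := by
    rw [hs, Real.sq_sqrt (by positivity)]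
    push_cast
    rfl
  have hs0 : 0 ≤ s := Real.sqrt_nonneg _
  have hsirr : Irrational s := by
    rw [hs, irrational_sqrt_natCast_iff]
    rintro ⟨k, hk⟩
    have h1 : (b : ℕ) < k := by nlinarith
    have h2 : k < (b : ℕ) + 1 := by nlinarith
    omega
  have hlt : ((b : ℕ) : ℝ) < s := by nlinarith
  have hlt' : s < (b : ℕ) + 2 := by nlinarith
  have hmem : (s - (b : ℕ)) / 2 ∈ Set.Ioo (0 : ℝ) 1 := ⟨by linarith, by linarith⟩
  have hfix : 1 / ((b : ℕ) + (s - (b : ℕ)) / 2) = (s - (b : ℕ)) / 2 := by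
    rw [div_eq_iff (by linarith)]
    nlinarith
  have hg := gaussMap_inverseBranch b hmem
  have hd := gaussDigit_inverseBranch b hmem
  rw [hfix] at hg hd
  refine ⟨(s - (b : ℕ)) / 2, (mem_contFractSet_iff hI).2 ⟨hmem, ?_, fun n => ?_⟩⟩
  · exact_mod_cast (hsirr.sub_natCast (b : ℕ)).div_natCast (m := 2) (by norm_num)
  · rwa [Function.iterate_fixed hg, hd]

/-! ### Bounds for covering numbers. -/

theorem exists_finset_cover_contFractSet (I : Set ℕ+) {r : ℝ} (hr : 0 < r) :
    ∃ C : Finset ℝ, contFractSet I ⊆ ⋃ x ∈ C, Metric.ball x r := by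
  have h : TotallyBounded (contFractSet I) :=
    (totallyBounded_Icc (0 : ℝ) 1).subset fun x hx => Set.Ioo_subset_Icc_self hx.1
  obtain ⟨t, ht, hcov⟩ := Metric.totallyBounded_iff.1 h r hr
  exact ⟨ht.toFinset, by simpa using hcov⟩

theorem le_ballCoveringNumber_contFractSet {I : Set ℕ+} {r : ℝ} (hr : 0 < r) {T : Finset ℝ}
    (hT : ∀ x ∈ T, x ∈ contFractSet I)
    (hsep : ∀ x ∈ T, ∀ y ∈ T, x ≠ y → 2 * r ≤ |x - y|) :
    T.card ≤ ballCoveringNumber r (contFractSet I) := by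
  -- A finite cover must exist, since `sInf ∅ = 0` would defeat a lower bound.
  obtain ⟨C₀, hC₀⟩ := exists_finset_cover_contFractSet I hr
  refine le_csInf ⟨_, C₀, rfl, hC₀⟩ ?_
  rintro n ⟨C, rfl, hC⟩
  have hex : ∀ x ∈ T, ∃ c ∈ C, x ∈ Metric.ball c r := fun x hx => by
    simpa using hC (hT x hx)
  choose! f hf hfball using hex
  refine Finset.card_le_card_of_injOn f hf fun x hx y hy hxy => ?_
  by_contra hne
  have h1 := hfball x hx
  have h2 := hfball y hy
  rw [← hxy] at h2
  rw [Metric.mem_ball] at h1 h2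
  have h3 := hsep x hx y hy hne
  rw [← Real.dist_eq] at h3
  linarith [dist_triangle_right x y (f x)]

/-- If every digit of `I` is in the finite set `F` or exceeds `1 / r`, and `∑ b ∈ F, b ^ (-2 s)` is
at most `1 / 2`, then at all scales above `r` the set `Λ_I` looks at most `s`-dimensional. -/
theorem exists_cover_card_le {I : Set ℕ+} {F : Finset ℕ+} {r s M : ℝ} (hr : 0 < r) (hs : 0 ≤ s)
    (hI : ∀ b ∈ I, b ∈ F ∨ 1 / r ≤ (b : ℕ)) (hF2 : ∀ b ∈ F, 2 ≤ b)
    (hFM : ∀ b ∈ F, ((b : ℕ) : ℝ) ≤ M)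
    (hsum : ∑ b ∈ F, ((b : ℕ) : ℝ) ^ (-(2 * s)) ≤ 1 / 2) {ρ : ℝ} (hrρ : r ≤ ρ) (hρM : ρ ≤ M ^ 2) :
    ∃ C : Finset ℝ, (∀ x ∈ C, 0 ≤ x) ∧ contFractSet I ⊆ ⋃ x ∈ C, Metric.ball x ρ ∧
      (C.card : ℝ) ≤ 2 * (M ^ 2) ^ s * ρ ^ (-s) := by
  classical
  have hbase : ∀ σ, r ≤ σ → σ ≤ M ^ 2 → 1 ≤ (M ^ 2) ^ s * σ ^ (-s) := fun σ hσ hσM => by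
    have hσ0 := hr.trans_le hσ
    rw [Real.rpow_neg hσ0.le, ← div_eq_mul_inv, one_le_div (by positivity)]
    exact Real.rpow_le_rpow hσ0.le hσM hs
  -- Induction from coarse to fine scales: the branch of `b` turns a cover at scale `b² ρ` into one
  -- at scale `ρ`, and `b ≥ 2` lowers `n`.
  obtain ⟨n, hn⟩ := exists_pow_lt_of_lt_one (hr.trans_le hrρ) (by norm_num : (1 / 2 : ℝ) < 1)
  induction n generalizing ρ with
  | zero =>
    refine ⟨{0}, by simp, fun x hx => ?_, ?_⟩
    · simp only [Finset.mem_singleton, Set.iUnion_iUnion_eq_left, Metric.mem_ball, Real.dist_eq,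
        sub_zero, abs_of_pos hx.1.1]
      exact hx.1.2.trans (by simpa using hn)
    · simp only [Finset.card_singleton, Nat.cast_one]
      linarith [hbase ρ hrρ hρM]
  | succ n ih =>
    have hρ0 := hr.trans_le hrρ
    by_cases hρ1 : 1 < ρ
    · exact ih hrρ hρM (lt_of_le_of_lt (pow_le_one₀ (by norm_num) (by norm_num)) hρ1)
    have hC : ∀ b ∈ F, ∃ C : Finset ℝ, (∀ x ∈ C, 0 ≤ x) ∧
        contFractSet I ⊆ ⋃ x ∈ C, Metric.ball x (((b : ℕ) : ℝ) ^ 2 * ρ) ∧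
        (C.card : ℝ) ≤ 2 * (M ^ 2) ^ s * (((b : ℕ) : ℝ) ^ 2 * ρ) ^ (-s) := fun b hb => by
      have h2 : (2 : ℝ) ≤ (b : ℕ) := by exact_mod_cast hF2 b hb
      have h4 : (4 : ℝ) ≤ ((b : ℕ) : ℝ) ^ 2 := by nlinarith
      have hbM : ((b : ℕ) : ℝ) ^ 2 ≤ M ^ 2 := by gcongr; exact hFM b hb
      refine ih (by nlinarith) (by nlinarith) ?_
      rw [pow_succ] at hn
      nlinarith
    choose! C hC0 hCcov hCcard using hC
    refine ⟨insert 0 (F.biUnion fun b => (C b).image fun x => 1 / (((b : ℕ) : ℝ) + x)),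
      ?_, fun x hx => ?_, ?_⟩
    · intro x hx
      simp only [Finset.mem_insert, Finset.mem_biUnion, Finset.mem_image] at hx
      rcases hx with rfl | ⟨b, hb, y, hy, rfl⟩
      · exact le_rfl
      · have := hC0 b hb y hy
        positivity
    · obtain ⟨b, hb, w, hw, rfl⟩ := exists_inverseBranch_of_mem_contFractSet hx
      have h1 : (1 : ℝ) ≤ (b : ℕ) := Nat.one_le_cast.2 b.pos
      have hw0 := hw.1.1
      simp only [Set.mem_iUnion, exists_prop]
      rcases hI b hb with hbF | hbr
      · have hwc := hCcov b hbF hw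
        simp only [Set.mem_iUnion, exists_prop] at hwc
        obtain ⟨y, hy, hwy⟩ := hwc
        refine ⟨1 / ((b : ℕ) + y), Finset.mem_insert_of_mem (Finset.mem_biUnion.2
          ⟨b, hbF, Finset.mem_image_of_mem _ hy⟩), ?_⟩
        rw [Metric.mem_ball, Real.dist_eq] at hwy ⊢
        refine (abs_inverseBranch_sub_le h1 hw0.le (hC0 b hbF y hy)).trans_lt ?_
        rw [div_lt_iff₀ (by positivity)]
        linarith
      -- Here `1 / (b + w) < 1 / b ≤ r ≤ ρ`.
      · refine ⟨0, Finset.mem_insert_self _ _, ?_⟩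
        rw [Metric.mem_ball, Real.dist_eq, sub_zero, abs_of_pos (by positivity),
          div_lt_iff₀ (by positivity)]
        rw [div_le_iff₀ hr] at hbr
        nlinarith
    · have hcard : ((insert 0 (F.biUnion fun b =>
          (C b).image fun x => 1 / (((b : ℕ) : ℝ) + x))).card : ℝ) ≤
          1 + ∑ b ∈ F, ((C b).card : ℝ) := by
        have h : (insert 0 (F.biUnion fun b =>
          (C b).image fun x => 1 / (((b : ℕ) : ℝ) + x))).card ≤ 1 + ∑ b ∈ F, (C b).card := by
          refine (Finset.card_insert_le _ _).trans ?_
          rw [add_comm]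
          gcongr
          exact Finset.card_biUnion_le.trans (Finset.sum_le_sum fun b _ => Finset.card_image_le)
        exact_mod_cast h
      refine hcard.trans ?_
      have hsum' : ∑ b ∈ F, ((C b).card : ℝ) ≤
          2 * (M ^ 2) ^ s * ρ ^ (-s) * ∑ b ∈ F, ((b : ℕ) : ℝ) ^ (-(2 * s)) := by
        rw [Finset.mul_sum]
        refine Finset.sum_le_sum fun b hb => (hCcard b hb).trans_eq ?_
        rw [Real.mul_rpow (by positivity) hρ0.le, ← mul_neg, Real.rpow_mul (Nat.cast_nonneg _),
          Real.rpow_two]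
        ring
      -- With `A = (M²)ˢ ρ⁻ˢ ≥ 1`, the count is at most `1 + 2A · (1/2) ≤ 2A`; the factor `2`
      -- absorbs the extra ball.
      have h1 := hbase ρ hrρ hρM
      nlinarith

theorem ballCoveringNumber_contFractSet_le {I : Set ℕ+} {F : Finset ℕ+} {r s M : ℝ} (hr : 0 < r)
    (hs : 0 ≤ s) (hI : ∀ b ∈ I, b ∈ F ∨ 1 / r ≤ (b : ℕ)) (hF2 : ∀ b ∈ F, 2 ≤ b)
    (hFM : ∀ b ∈ F, ((b : ℕ) : ℝ) ≤ M) (hM : 1 ≤ M)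
    (hsum : ∑ b ∈ F, ((b : ℕ) : ℝ) ^ (-(2 * s)) ≤ 1 / 2) (hr1 : r ≤ 1) :
    (ballCoveringNumber r (contFractSet I) : ℝ) ≤ 2 * (M ^ 2) ^ s * r ^ (-s) := by
  obtain ⟨C, -, hC, hcard⟩ := exists_cover_card_le hr hs hI hF2 hFM hsum le_rfl
    (hr1.trans (one_le_pow₀ hM))
  refine le_trans ?_ hcard
  have h : ballCoveringNumber r (contFractSet I) ≤ C.card := Nat.sInf_le ⟨C, rfl, hC⟩
  exact_mod_cast h

/-- Points of `Λ_I` with well separated first digits are well separated. -/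
theorem card_le_ballCoveringNumber_contFractSet {I : Set ℕ+} (hne : (contFractSet I).Nonempty)
    {B : Finset ℕ+} {r : ℝ} (hr : 0 < r) (hB : ∀ b ∈ B, b ∈ I)
    (hsep : ∀ b ∈ B, ∀ d ∈ B, b < d → 2 * r ≤ 1 / (((b : ℕ) : ℝ) + 1) - 1 / (d : ℕ)) :
    B.card ≤ ballCoveringNumber r (contFractSet I) := by
  classical
  -- One common tail `w` serves all first digits.
  obtain ⟨w, hw⟩ := hne
  have key : ∀ b ∈ B, ∀ d ∈ B, b < d →
      2 * r ≤ 1 / (((b : ℕ) : ℝ) + w) - 1 / ((d : ℕ) + w) := fun b hb d hd hbd => by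
    have hb1 : (0 : ℝ) < (b : ℕ) := Nat.cast_pos.2 b.pos
    have hd1 : (0 : ℝ) < (d : ℕ) := Nat.cast_pos.2 d.pos
    have hw0 := hw.1.1
    refine (hsep b hb d hd hbd).trans (sub_le_sub ?_ ?_)
    · exact one_div_le_one_div_of_le (by positivity) (by linarith [hw.1.2])
    · exact one_div_le_one_div_of_le (by positivity) (by linarith)
  have key' : ∀ b ∈ B, ∀ d ∈ B, b ≠ d →
      2 * r ≤ |1 / (((b : ℕ) : ℝ) + w) - 1 / ((d : ℕ) + w)| := fun b hb d hd hbd => by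
    rcases hbd.lt_or_gt with h | h
    · exact (key b hb d hd h).trans (le_abs_self _)
    · rw [abs_sub_comm]
      exact (key d hd b hb h).trans (le_abs_self _)
  rw [← Finset.card_image_of_injOn (f := fun b : ℕ+ => 1 / (((b : ℕ) : ℝ) + w))]
  · refine le_ballCoveringNumber_contFractSet hr ?_ ?_
    · simp only [Finset.mem_image]
      rintro _ ⟨b, hb, rfl⟩
      exact inverseBranch_mem_contFractSet (hB b hb) hw
    · simp only [Finset.mem_image]
      rintro _ ⟨b, hb, rfl⟩ _ ⟨d, hd, rfl⟩ hne
      exact key' b hb d hd fun h => hne (by rw [h])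
  · intro b hb d hd hbd
    by_contra hne
    have h := key' b hb d hd hne
    simp only at hbd
    rw [hbd, sub_self, abs_zero] at h
    linarith

/-! ### Criterion for the box dimension not to exist. -/

theorem not_boxDimExists_of_frequently {X : Type*} [MetricSpace X] {E : Set X} {p q : ℝ}
    (hpq : p < q)
    (hp : ∃ᶠ r in 𝓝[>] (0 : ℝ), Real.log (ballCoveringNumber r E) / Real.log (1 / r) ≤ p)
    (hq : ∃ᶠ r in 𝓝[>] (0 : ℝ), q ≤ Real.log (ballCoveringNumber r E) / Real.log (1 / r)) :
    ¬ BoxDimExists E := by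
  intro h
  have h1 : lowerBoxDim E ≤ (p : EReal) :=
    liminf_le_of_frequently_le' (hp.mono fun r hr => EReal.coe_le_coe_iff.2 hr)
  have h2 : (q : EReal) ≤ upperBoxDim E :=
    le_limsup_of_frequently_le' (hq.mono fun r hr => EReal.coe_le_coe_iff.2 hr)
  rw [BoxDimExists] at h
  exact absurd (EReal.coe_le_coe_iff.1 (h2.trans (h ▸ h1))) (not_le.2 hpq)

theorem frequently_nhdsGT_zero_of_tendsto {P : ℝ → Prop} {u : ℕ → ℝ}
    (hu : Tendsto u atTop (𝓝 0)) (hpos : ∀ n, 0 < u n) (hP : ∀ n, P (u n)) :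
    ∃ᶠ r in 𝓝[>] (0 : ℝ), P r :=
  (tendsto_nhdsWithin_iff.2 ⟨hu, Eventually.of_forall hpos⟩).frequently
    (Frequently.of_forall hP)

/-! ### A single block of digits. -/

/-- The `m` digits `m², m² + m, …, 2 m² - m`. -/
def digitBlock (m : ℕ) : Finset ℕ+ :=
  (Finset.range m).image fun j => (m ^ 2 + j * m).toPNat'

theorem digitBlock_coe {m : ℕ} (hm : 0 < m) (j : ℕ) :
    ((m ^ 2 + j * m).toPNat' : ℕ) = m ^ 2 + j * m := by
  rw [Nat.toPNat'_coe, if_pos (by positivity)]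

theorem mem_digitBlock {m : ℕ} (hm : 0 < m) {b : ℕ+} :
    b ∈ digitBlock m ↔ ∃ j < m, (b : ℕ) = m ^ 2 + j * m := by
  simp only [digitBlock, Finset.mem_image, Finset.mem_range]
  refine exists_congr fun j => and_congr_right fun _ => ?_
  rw [← PNat.coe_inj, digitBlock_coe hm, eq_comm]

theorem card_digitBlock {m : ℕ} (hm : 0 < m) : (digitBlock m).card = m := by
  rw [digitBlock, Finset.card_image_of_injective, Finset.card_range]
  intro i j hij
  have h := congrArg ((↑) : ℕ+ → ℕ) hij
  simp only [digitBlock_coe hm] at h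
  exact Nat.eq_of_mul_eq_mul_right hm (Nat.add_left_cancel h)

theorem sq_le_of_mem_digitBlock {m : ℕ} (hm : 0 < m) {b : ℕ+} (hb : b ∈ digitBlock m) :
    m ^ 2 ≤ (b : ℕ) := by
  obtain ⟨j, -, h⟩ := (mem_digitBlock hm).1 hb
  omega

theorem add_le_two_mul_sq_of_mem_digitBlock {m : ℕ} (hm : 0 < m) {b : ℕ+}
    (hb : b ∈ digitBlock m) : (b : ℕ) + m ≤ 2 * m ^ 2 := by
  obtain ⟨j, hj, h⟩ := (mem_digitBlock hm).1 hb
  nlinarith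

theorem add_le_of_mem_digitBlock_of_lt {m : ℕ} (hm : 0 < m) {b d : ℕ+} (hb : b ∈ digitBlock m)
    (hd : d ∈ digitBlock m) (hbd : b < d) : (b : ℕ) + m ≤ d := by
  obtain ⟨i, -, hi⟩ := (mem_digitBlock hm).1 hb
  obtain ⟨j, -, hj⟩ := (mem_digitBlock hm).1 hd
  have hbd' : (b : ℕ) < d := hbd
  rw [hi, hj] at hbd' ⊢
  have hij : i < j := lt_of_mul_lt_mul_right (by omega : i * m < j * m) hm.le
  nlinarith

theorem separation_of_mem_digitBlock {m : ℕ} (hm : 2 ≤ m) {b d : ℕ+} (hb : b ∈ digitBlock m)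
    (hd : d ∈ digitBlock m) (hbd : b < d) :
    2 * (1 / (16 * (m : ℝ) ^ 3)) ≤ 1 / (((b : ℕ) : ℝ) + 1) - 1 / (d : ℕ) := by
  have hm0 : 0 < m := by omega
  have hm2 : (2 : ℝ) ≤ m := by exact_mod_cast hm
  have h1 : ((b : ℕ) : ℝ) + m ≤ (d : ℕ) := by
    exact_mod_cast add_le_of_mem_digitBlock_of_lt hm0 hb hd hbd
  have h2 : ((d : ℕ) : ℝ) + m ≤ 2 * (m : ℝ) ^ 2 := by
    exact_mod_cast add_le_two_mul_sq_of_mem_digitBlock hm0 hd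
  have hb0 : (0 : ℝ) < (b : ℕ) := Nat.cast_pos.2 b.pos
  have hd0 : (0 : ℝ) < (d : ℕ) := Nat.cast_pos.2 d.pos
  have hprod : (((b : ℕ) : ℝ) + 1) * (d : ℕ) ≤ 2 * (m : ℝ) ^ 2 * (2 * (m : ℝ) ^ 2) := by
    gcongr <;> linarith
  have hdiff : (m : ℝ) / 2 ≤ (d : ℕ) - (((b : ℕ) : ℝ) + 1) := by linarith
  -- The gap is at least `m - 1 ≥ m / 2`, and both denominators are at most `2m²`.
  rw [div_sub_div _ _ (by positivity) (by positivity), one_mul, mul_one]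
  calc 2 * (1 / (16 * (m : ℝ) ^ 3)) = (m / 2) / (2 * (m : ℝ) ^ 2 * (2 * (m : ℝ) ^ 2)) := by
        field_simp
        norm_num
    _ ≤ _ := div_le_div₀ (by linarith) hdiff (by positivity) hprod

/-- With `m = t⁵` there are `t⁵` terms, each at most `(t¹⁰) ^ (-3/5) = t⁻⁶`; the fifth power keeps
the exponents integral. -/
theorem sum_digitBlock_rpow_le {t : ℕ} (ht : 0 < t) :
    ∑ b ∈ digitBlock (t ^ 5), ((b : ℕ) : ℝ) ^ (-(2 * (3 / 10)) : ℝ) ≤ 1 / t := by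
  have htpos : (0 : ℝ) < t := Nat.cast_pos.2 ht
  have hb : ∀ b ∈ digitBlock (t ^ 5), ((b : ℕ) : ℝ) ^ (-(2 * (3 / 10)) : ℝ) ≤ 1 / (t : ℝ) ^ 6 := by
    intro b hb
    have h : ((t : ℝ) ^ 10) ≤ (b : ℕ) := by
      have := sq_le_of_mem_digitBlock (pow_pos ht 5) hb
      rw [← pow_mul] at this
      exact_mod_cast this
    refine (Real.rpow_le_rpow_of_nonpos (by positivity) h (by norm_num)).trans_eq ?_
    rw [← Real.rpow_natCast, ← Real.rpow_mul htpos.le, one_div, ← Real.rpow_natCast,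
      ← Real.rpow_neg htpos.le]
    norm_num
  refine (Finset.sum_le_card_nsmul _ _ _ hb).trans_eq ?_
  rw [card_digitBlock (pow_pos ht 5), nsmul_eq_mul]
  push_cast
  field_simp

/-! ### The sparse alphabet. -/

/-- The scales at which the digit blocks are placed; they grow superexponentially. -/
def blockScale (c k : ℕ) : ℕ := (2 ^ (c * 100 ^ k)) ^ 5

/-- The digits: a union of blocks at very sparse scales. -/
def sparseDigits (c : ℕ) : Set ℕ+ := {b | ∃ k, b ∈ digitBlock (blockScale c k)}

theorem blockScale_pos (c k : ℕ) : 0 < blockScale c k := by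
  unfold blockScale
  positivity

theorem blockScale_succ (c k : ℕ) : blockScale c (k + 1) = blockScale c k ^ 100 := by
  simp only [blockScale, ← pow_mul]
  ring_nf

theorem blockScale_mono (c : ℕ) : Monotone (blockScale c) := fun i j hij => by
  unfold blockScale
  gcongr <;> norm_num

theorem two_pow_le_blockScale {c : ℕ} (hc : 7 ≤ c) (k : ℕ) : 2 ^ (k + 35) ≤ blockScale c k := by
  rw [blockScale, ← pow_mul]
  refine Nat.pow_le_pow_right two_pos ?_
  have h : k < 100 ^ k := Nat.lt_pow_self (by norm_num)
  nlinarith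

theorem le_of_mem_sparseDigits {c : ℕ} {b : ℕ+} (hb : b ∈ sparseDigits c) : c ≤ (b : ℕ) := by
  obtain ⟨k, hk⟩ := hb
  calc c ≤ 2 ^ (c * 100 ^ k) := (Nat.le_mul_of_pos_right c (by positivity)).trans
        Nat.lt_two_pow_self.le
    _ ≤ blockScale c k := Nat.le_self_pow (by norm_num) _
    _ ≤ blockScale c k ^ 2 := Nat.le_self_pow (by norm_num) _
    _ ≤ b := sq_le_of_mem_digitBlock (blockScale_pos c k) hk

theorem sparseDigits_infinite {c : ℕ} (hc : 7 ≤ c) : (sparseDigits c).Infinite := by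
  refine Set.infinite_of_forall_exists_gt fun n => ?_
  have hpos := blockScale_pos c n
  obtain ⟨b, hb⟩ : (digitBlock (blockScale c n)).Nonempty := by
    rw [← Finset.card_pos, card_digitBlock hpos]
    exact hpos
  refine ⟨b, ⟨n, hb⟩, ?_⟩
  rw [← PNat.coe_lt_coe]
  calc (n : ℕ) < 2 ^ (n : ℕ) := Nat.lt_two_pow_self
    _ ≤ 2 ^ ((n : ℕ) + 35) := Nat.pow_le_pow_right two_pos (by omega)
    _ ≤ blockScale c n := two_pow_le_blockScale hc n
    _ ≤ blockScale c n ^ 2 := Nat.le_self_pow (by norm_num) _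
    _ ≤ b := sq_le_of_mem_digitBlock hpos hb

/-- Makes disjointness of the blocks unnecessary. -/
theorem sum_biUnion_le_sum_sum {ι α : Type*} [DecidableEq α] (s : Finset ι) (t : ι → Finset α)
    {f : α → ℝ} (hf : ∀ a, 0 ≤ f a) :
    ∑ a ∈ s.biUnion t, f a ≤ ∑ i ∈ s, ∑ a ∈ t i, f a := by
  classical
  induction s using Finset.induction_on with
  | empty => simp
  | insert i s hi ih =>
    rw [Finset.biUnion_insert, Finset.sum_insert hi]
    have h := Finset.sum_union_inter (s₁ := t i) (s₂ := s.biUnion t) (f := f)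
    have h' : 0 ≤ ∑ a ∈ t i ∩ s.biUnion t, f a := Finset.sum_nonneg fun a _ => hf a
    linarith

theorem sum_biUnion_digitBlock_rpow_le {c : ℕ} (hc : 7 ≤ c) (k : ℕ) :
    ∑ b ∈ (Finset.range k).biUnion fun j => digitBlock (blockScale c j),
      ((b : ℕ) : ℝ) ^ (-(2 * (3 / 10)) : ℝ) ≤ 1 / 2 := by
  refine (sum_biUnion_le_sum_sum _ _ (fun _ => by positivity)).trans ?_
  have h : ∑ j ∈ Finset.range k, ∑ b ∈ digitBlock (blockScale c j),
      ((b : ℕ) : ℝ) ^ (-(2 * (3 / 10)) : ℝ) ≤ ∑ j ∈ Finset.range k, (1 / 2 : ℝ) ^ (j + 2) := by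
    refine Finset.sum_le_sum fun j _ => (sum_digitBlock_rpow_le (by positivity)).trans ?_
    rw [one_div_pow]
    refine one_div_le_one_div_of_le (by positivity) ?_
    have hj : j < 100 ^ j := Nat.lt_pow_self (by norm_num)
    exact_mod_cast Nat.pow_le_pow_right two_pos (by nlinarith : j + 2 ≤ c * 100 ^ j)
  have hgeom (n : ℕ) :
      ∑ j ∈ Finset.range n, (1 / 2 : ℝ) ^ (j + 2) = 1 / 2 - (1 / 2) ^ (n + 1) := by
    induction n with
    | zero => norm_num
    | succ n ih =>
      rw [Finset.sum_range_succ, ih]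
      ring
  rw [hgeom] at h
  have : (0 : ℝ) ≤ (1 / 2) ^ (k + 1) := by positivity
  linarith

theorem two_le_of_mem_sparseDigits {c : ℕ} (hc : 7 ≤ c) {b : ℕ+} (hb : b ∈ sparseDigits c) :
    2 ≤ b := by
  rw [← PNat.coe_le_coe]
  exact (show 2 ≤ c by omega).trans (le_of_mem_sparseDigits hb)

theorem sparse_ballCoveringNumber_le {c : ℕ} (hc : 7 ≤ c) (k : ℕ) :
    (ballCoveringNumber (1 / (blockScale c (k + 1) : ℝ) ^ 2) (contFractSet (sparseDigits c)) : ℝ) ≤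
      2 * ((2 * (blockScale c k : ℝ) ^ 2) ^ 2) ^ (3 / 10 : ℝ) *
        (1 / (blockScale c (k + 1) : ℝ) ^ 2) ^ (-(3 / 10) : ℝ) := by
  have hone (j : ℕ) : (1 : ℝ) ≤ blockScale c j := Nat.one_le_cast.2 (blockScale_pos c j)
  have hmem : ∀ b ∈ (Finset.range (k + 1)).biUnion fun j => digitBlock (blockScale c j),
      ∃ j ≤ k, b ∈ digitBlock (blockScale c j) := fun b hb => by
    obtain ⟨j, hj, hb⟩ := Finset.mem_biUnion.1 hb
    exact ⟨j, Nat.lt_succ_iff.1 (Finset.mem_range.1 hj), hb⟩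
  refine ballCoveringNumber_contFractSet_le
    (F := (Finset.range (k + 1)).biUnion fun j => digitBlock (blockScale c j))
    (by have := hone (k + 1); positivity) (by norm_num) ?_ ?_ ?_ ?_
    (sum_biUnion_digitBlock_rpow_le hc (k + 1)) ?_
  · rintro b ⟨j, hb⟩
    rcases lt_or_ge j (k + 1) with hj | hj
    · exact Or.inl (Finset.mem_biUnion.2 ⟨j, Finset.mem_range.2 hj, hb⟩)
    · right
      rw [one_div_one_div]
      have h := (Nat.pow_le_pow_left (blockScale_mono c hj) 2).trans
        (sq_le_of_mem_digitBlock (blockScale_pos c j) hb)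
      exact_mod_cast h
  · intro b hb
    obtain ⟨j, -, hb⟩ := hmem b hb
    exact two_le_of_mem_sparseDigits hc ⟨j, hb⟩
  · intro b hb
    obtain ⟨j, hj, hb⟩ := hmem b hb
    have h1 := add_le_two_mul_sq_of_mem_digitBlock (blockScale_pos c j) hb
    have h2 := Nat.pow_le_pow_left (blockScale_mono c hj) 2
    have h3 : (b : ℕ) ≤ 2 * blockScale c k ^ 2 := by omega
    exact_mod_cast h3
  · nlinarith [hone k]
  · rw [div_le_one (by have := hone (k + 1); positivity)]
    exact one_le_pow₀ (hone (k + 1))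

/-! ### The two sequences of scales. -/

/-- The constant `32` is exactly what `le_sparse_ratio` needs; `c ≥ 7` gives `5c ≥ 35`. -/
theorem log_blockScale_ge {c : ℕ} (hc : 7 ≤ c) (k : ℕ) :
    32 * Real.log 2 ≤ Real.log (blockScale c k) := by
  rw [← Real.log_rpow two_pos]
  refine Real.log_le_log (by positivity) ?_
  have h : 2 ^ 32 ≤ blockScale c k :=
    (Nat.pow_le_pow_right two_pos (by omega)).trans (two_pow_le_blockScale hc k)
  exact_mod_cast h

theorem sparse_ratio_le {c : ℕ} (hc : 7 ≤ c) (k : ℕ) :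
    Real.log (ballCoveringNumber (1 / (blockScale c (k + 1) : ℝ) ^ 2)
      (contFractSet (sparseDigits c))) / Real.log (1 / (1 / (blockScale c (k + 1) : ℝ) ^ 2)) ≤
      31 / 100 := by
  have hm : (0 : ℝ) < blockScale c k := Nat.cast_pos.2 (blockScale_pos c k)
  have hm' : (0 : ℝ) < blockScale c (k + 1) := Nat.cast_pos.2 (blockScale_pos c (k + 1))
  have hlog := log_blockScale_ge hc k
  have hlog2 : 0 < Real.log 2 := Real.log_pos one_lt_two
  have hsucc : Real.log (blockScale c (k + 1)) = 100 * Real.log (blockScale c k) := by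
    rw [blockScale_succ]
    push_cast
    rw [Real.log_pow]
    norm_num
  rcases Nat.eq_zero_or_pos (ballCoveringNumber (1 / (blockScale c (k + 1) : ℝ) ^ 2)
    (contFractSet (sparseDigits c))) with h0 | hpos
  · rw [h0]
    norm_num
  have h := Real.log_le_log (Nat.cast_pos.2 hpos) (sparse_ballCoveringNumber_le hc k)
  rw [Real.log_mul (by positivity) (by positivity), Real.log_mul (by positivity) (by positivity),
    Real.log_rpow (by positivity), Real.log_rpow (by positivity), Real.log_pow,
    Real.log_mul (by positivity) (by positivity), Real.log_pow, one_div, Real.log_inv,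
    Real.log_pow, hsucc] at h
  rw [one_div_one_div, Real.log_pow, hsucc, div_le_iff₀ (by push_cast; linarith), one_div]
  push_cast at h ⊢
  -- With `L = log m_k`, this is `1.6 log 2 + 61.2 L ≤ 62 L`.
  linarith

theorem le_sparse_ratio {c : ℕ} (hc : 7 ≤ c) (k : ℕ) :
    32 / 100 ≤ Real.log (ballCoveringNumber (1 / (16 * (blockScale c k : ℝ) ^ 3))
      (contFractSet (sparseDigits c))) / Real.log (1 / (1 / (16 * (blockScale c k : ℝ) ^ 3))) := by
  have hm : (0 : ℝ) < blockScale c k := Nat.cast_pos.2 (blockScale_pos c k)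
  have hm2 : 2 ≤ blockScale c k :=
    (Nat.le_self_pow (by omega) 2).trans (two_pow_le_blockScale hc k)
  have hlog := log_blockScale_ge hc k
  have hlog2 : 0 < Real.log 2 := Real.log_pos one_lt_two
  have hne := contFractSet_nonempty (fun b hb => two_le_of_mem_sparseDigits hc hb)
    (sparseDigits_infinite hc).nonempty
  have hcard := card_le_ballCoveringNumber_contFractSet hne (B := digitBlock (blockScale c k))
    (r := 1 / (16 * (blockScale c k : ℝ) ^ 3)) (by positivity) (fun b hb => ⟨k, hb⟩)
    fun b hb d hd hbd => separation_of_mem_digitBlock hm2 hb hd hbd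
  rw [card_digitBlock (blockScale_pos c k)] at hcard
  have h := Real.log_le_log hm (Nat.cast_le.2 hcard)
  have h16 : Real.log 16 = 4 * Real.log 2 := by
    rw [show (16 : ℝ) = 2 ^ 4 by norm_num, Real.log_pow]
    norm_num
  have hden : Real.log (1 / (1 / (16 * (blockScale c k : ℝ) ^ 3))) =
      4 * Real.log 2 + 3 * Real.log (blockScale c k) := by
    rw [one_div_one_div, Real.log_mul (by norm_num) (by positivity), Real.log_pow, h16]
    norm_num
  rw [hden, le_div_iff₀ (by linarith)]
  -- `0.32 (4 log 2 + 3L) ≤ L` is equivalent to `L ≥ 32 log 2`.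
  linarith

theorem tendsto_blockScale_cast {c : ℕ} (hc : 7 ≤ c) :
    Tendsto (fun k => (blockScale c k : ℝ)) atTop atTop := by
  refine tendsto_natCast_atTop_atTop.comp (tendsto_atTop_mono (fun k => ?_) tendsto_id)
  calc k ≤ 2 ^ k := Nat.lt_two_pow_self.le
    _ ≤ 2 ^ (k + 35) := Nat.pow_le_pow_right two_pos (by omega)
    _ ≤ blockScale c k := two_pow_le_blockScale hc k

theorem not_boxDimExists_contFractSet_sparseDigits {c : ℕ} (hc : 7 ≤ c) :
    ¬ BoxDimExists (contFractSet (sparseDigits c)) := by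
  have hpos (k : ℕ) : (0 : ℝ) < blockScale c k := Nat.cast_pos.2 (blockScale_pos c k)
  have htop := tendsto_blockScale_cast hc
  refine not_boxDimExists_of_frequently (by norm_num : (31 / 100 : ℝ) < 32 / 100)
    (frequently_nhdsGT_zero_of_tendsto ?_ (fun k => ?_) (sparse_ratio_le hc))
    (frequently_nhdsGT_zero_of_tendsto ?_ (fun k => ?_) (le_sparse_ratio hc))
  · exact tendsto_const_nhds.div_atTop
      ((tendsto_pow_atTop two_ne_zero).comp (htop.comp (tendsto_add_atTop_nat 1)))
  · have := hpos (k + 1)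
    positivity
  · exact tendsto_const_nhds.div_atTop
      (((tendsto_pow_atTop three_ne_zero).comp htop).const_mul_atTop (by norm_num))
  · have := hpos k
    positivity

theorem contFractSet_sparseDigits_subset_Ioo {c : ℕ} {a : ℝ} (ha : 0 < a) (hc : 1 / a ≤ c) :
    contFractSet (sparseDigits c) ⊆ Set.Ioo 0 a := by
  intro z hz
  obtain ⟨b, hb, w, hw, rfl⟩ := exists_inverseBranch_of_mem_contFractSet hz
  have h : (c : ℝ) ≤ (b : ℕ) := Nat.cast_le.2 (le_of_mem_sparseDigits hb)
  refine ⟨hz.1.1, ?_⟩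
  rw [one_div_lt (by linarith [hw.1.1, one_div_pos.2 ha]) ha]
  linarith [hw.1.1]

theorem theoremA :
    (∀ a : ℝ, 0 < a → a < 1 →
      ∃ I : Set ℕ+, I.Infinite ∧ I ≠ Set.univ ∧
        contFractSet I ⊆ Set.Ioo 0 a ∧ ¬ BoxDimExists (contFractSet I)) ∧
    (∃ Λ : Set ℝ, Λ ⊆ Set.Ioo 0 1 ∧ MeasurableSet Λ ∧ gaussMap '' Λ = Λ ∧ ¬ BoxDimExists Λ) := by
  refine ⟨fun a ha _ => ?_, contFractSet (sparseDigits 7), fun z hz => hz.1,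
    measurableSet_contFractSet fun b hb => two_le_of_mem_sparseDigits le_rfl hb,
    gaussMap_image_contFractSet (sparseDigits_infinite le_rfl).nonempty,
    not_boxDimExists_contFractSet_sparseDigits le_rfl⟩
  obtain ⟨n, hn⟩ := exists_nat_ge (1 / a)
  have hc : 7 ≤ max 7 n := le_max_left _ _
  refine ⟨sparseDigits (max 7 n), sparseDigits_infinite hc, fun h => ?_,
    contFractSet_sparseDigits_subset_Ioo ha
      (hn.trans (Nat.cast_le.2 (le_max_right _ _))),
    not_boxDimExists_contFractSet_sparseDigits hc⟩
  have h1 := two_le_of_mem_sparseDigits hc (h ▸ Set.mem_univ (1 : ℕ+))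
  exact absurd h1 (by decide)
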